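/- A (non-degenerate, thick-lined) polar space of rank $n$ is, in the sense of Tits, a set of points with a family of subsets, called singular subspaces, such that: (1) every singular subspace, together with the singular subspaces it contains, is a projective space of dimension $d$ with $-1\le d\le n-1$, in which every line has at least three points; (2) the intersection of two singular subspaces is a singular subspace; (3) if $V$ is a singular subspace of dimension $n-1$ and $p\notin V$ is a point, there is a unique singular subspace $W$ with $p\in W$ and $\dim(V\cap W)=n-2$, and $W$ contains every point of $V$ that is joined to $p$ by a line; (4) there are two disjoint singular subspaces of dimension $n-1$. It has order $(s,\dots,s,t)$ if every line has exactly $s+1$ points and every singular subspace of dimension $n-2$ is contained in exactly $t+1$ singular subspaces of dimension $n-1$. Let $\Delta$ be a finite polar space of rank $n>2$ and order $(s,\dots,s,t)$, where $s>1$ and $t\ge 1$ are integers with $t\in\{1,s^{1/2},s,s^{3/2},s^2\}$, and let $\Delta_i$ denote the set of singular subspaces of $\Delta$ of (projective) dimension $i$. Let $0\le i<j\le n-1$. Then: (a) if $|\Delta_i|\ge|\Delta_j|$, then $2n+\log_s t<\frac{3}{2}(i+j+3)$; (b) if $|\Delta_i|\le|\Delta_j|$, then $2n+\log_s t>\frac{3}{2}(i+j+1)$;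 (c) if $|\Delta_i|=|\Delta_j|$, then $2n+\log_s t-2\ \ge\ \frac{3}{2}(i+j)\ \ge\ 2n+\log_s t-4$. -/

import Mathlib

/-- Veblen–Young projective space on the point set `X` with line set `𝓛`; every line has at least
three points. The empty set and a single point (no lines), and a single line, are allowed. -/
structure IsProjectiveSpace {P : Type*} (X : Set P) (𝓛 : Set (Set P)) : Prop where
  line_subset : ∀ l ∈ 𝓛, l ⊆ X
  existsUnique_line : ∀ p ∈ X, ∀ q ∈ X, p ≠ q → ∃! l, l ∈ 𝓛 ∧ p ∈ l ∧ q ∈ l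
  three_points : ∀ l ∈ 𝓛, ∃ a ∈ l, ∃ b ∈ l, ∃ c ∈ l, a ≠ b ∧ a ≠ c ∧ b ≠ c
  /-- Veblen's axiom: two lines that meet both of two distinct lines through `p`, away from `p`,
  meet each other. -/
  veblen : ∀ l₁ ∈ 𝓛, ∀ l₂ ∈ 𝓛, ∀ m₁ ∈ 𝓛, ∀ m₂ ∈ 𝓛, ∀ p,
    l₁ ≠ l₂ → p ∈ l₁ → p ∈ l₂ → p ∉ m₁ → p ∉ m₂ →
    (m₁ ∩ l₁).Nonempty → (m₁ ∩ l₂).Nonempty → (m₂ ∩ l₁).Nonempty → (m₂ ∩ l₂).Nonempty →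
    (m₁ ∩ m₂).Nonempty

/-- `Y` contains, with any two of its points, every line of `𝓛` through both of them. -/
def IsLineClosed {P : Type*} (𝓛 : Set (Set P)) (Y : Set P) : Prop :=
  ∀ l ∈ 𝓛, ∀ p ∈ l, ∀ q ∈ l, p ≠ q → p ∈ Y → q ∈ Y → l ⊆ Y

/-- The set `S` of points of `X` generates `X` in the family `𝓕` of subspaces. -/
def Generates {P : Type*} (𝓕 : Set (Set P)) (S X : Set P) : Prop :=
  S ⊆ X ∧ ∀ Y ∈ 𝓕, S ⊆ Y → X ⊆ Y

/-- `X` is a member of the family `𝓕` and the least number of points generating `X` is `r`.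
In a projective space this says that `X` is a subspace of projective dimension `r - 1`:
the empty subspace has rank `0`, points have rank `1`, lines have rank `2`. -/
def HasRank {P : Type*} (𝓕 : Set (Set P)) (X : Set P) (r : ℕ) : Prop :=
  X ∈ 𝓕 ∧ IsLeast {k : ℕ | ∃ S : Finset P, S.card = k ∧ Generates 𝓕 (S : Set P) X} r

/-- A (non-degenerate, thick-lined) polar space of rank `n` with point set `P`, in the sense of
Tits: a family of subsets of `P`, the singular subspaces, subject to Tits' four axioms.
The rank is meant to be at least `1`. -/
structure PolarSpace (P : Type*) (n : ℕ) where
  subspaces : Set (Set P)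
  /-- A subspace, together with the subspaces it contains, is a projective space. -/
  projective : ∀ X ∈ subspaces, ∃ 𝓛 : Set (Set P), IsProjectiveSpace X 𝓛 ∧
    ∀ Y, Y ⊆ X → (Y ∈ subspaces ↔ IsLineClosed 𝓛 Y)
  /-- Its dimension `d` satisfies `-1 ≤ d ≤ n - 1`. -/
  rank_le : ∀ X ∈ subspaces, ∃ r ≤ n, HasRank subspaces X r
  inter_mem : ∀ X ∈ subspaces, ∀ Y ∈ subspaces, X ∩ Y ∈ subspaces
  /-- If `dim V = n - 1` and `p ∉ V`, there is a unique subspace `W` on `p` with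
  `dim (V ∩ W) = n - 2`. -/
  existsUnique_subspace : ∀ V, HasRank subspaces V n → ∀ p, p ∉ V →
    ∃! W, W ∈ subspaces ∧ p ∈ W ∧ HasRank subspaces (V ∩ W) (n - 1)
  /-- That `W` contains all points of `V` which are joined to `p` by a line. -/
  mem_of_joined : ∀ V, HasRank subspaces V n → ∀ p, p ∉ V →
    ∀ W ∈ subspaces, p ∈ W → HasRank subspaces (V ∩ W) (n - 1) →
    ∀ q ∈ V, (∃ l, HasRank subspaces l 2 ∧ p ∈ l ∧ q ∈ l) → q ∈ W
  /-- There are two disjoint subspaces of dimension `n - 1`. -/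
  exists_disjoint : ∃ V W, HasRank subspaces V n ∧ HasRank subspaces W n ∧ Disjoint V W

/-- The set of the singular subspaces of projective dimension `i`. -/
def PolarSpace.ofDim {P : Type*} {n : ℕ} (Δ : PolarSpace P n) (i : ℕ) : Set (Set P) :=
  {X | HasRank Δ.subspaces X (i + 1)}

/-- `Δ` has order `(s, s, …, s, t)`: every line has `s + 1` points, and every singular subspace of
dimension `n - 2` lies in exactly `t + 1` singular subspaces of dimension `n - 1`. -/
def PolarSpace.HasOrder {P : Type*} {n : ℕ} (Δ : PolarSpace P n) (s t : ℕ) : Prop :=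
  (∀ l ∈ Δ.ofDim 1, l.ncard = s + 1) ∧
  ∀ X ∈ Δ.ofDim (n - 2), {Y | Y ∈ Δ.ofDim (n - 1) ∧ X ⊆ Y}.ncard = t + 1

/-! Write [r] = 1 + s + ... + s^(r-1) (`projCard s r`) and let N_k be the number of singular
subspaces of rank k. Double counting incident pairs of ranks k and k + 1 gives, for n = k + d + 1,
N_{k+1} [k+1] = N_k [d+1] (1 + t s^d) (`HasOrder.ncard_hasRank_succ_mul`). Bounding each factor
between neighbouring powers of s places log_s of the ratio |Δ_{k+1}| / |Δ_k| in an open interval of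
length 3; summing over i ≤ k < j gives (a) and (b). For (c), 2 log_s t is an integer, so the doubled
strict inequalities hold between integers and improve by 1.

The geometric input is the number of covers of a rank k subspace X. Fix a subspace V ⊇ X of top
rank. Inside V there are [d+1] covers. By Tits' third axiom each cover outside V lies in a unique
top subspace meeting V in a hyperplane; there are [d+1] t such subspaces through X, each containing
s^d covers outside V.

All these counts rest on `hasRank_iff`: rank r means exactly [r] points, so ranks can be compared
through cardinalities. -/

/-- Double counting for a biregular relation between two sets. -/
theorem Set.ncard_mul_eq_ncard_mul_of_biregular {α β : Type*} [Finite α] [Finite β]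
    (A : Set α) (B : Set β) (r : α → β → Prop) {a b : ℕ}
    (hA : ∀ x ∈ A, {y | y ∈ B ∧ r x y}.ncard = a) (hB : ∀ y ∈ B, {x | x ∈ A ∧ r x y}.ncard = b) :
    A.ncard * a = B.ncard * b := by
  classical
  have := Fintype.ofFinite α
  have := Fintype.ofFinite β
  rw [Set.ncard_eq_toFinset_card' A, Set.ncard_eq_toFinset_card' B]
  refine Finset.card_mul_eq_card_mul r (fun x hx => ?_) (fun y hy => ?_)
  · rw [← hA x (by simpa using hx), Set.ncard_eq_toFinset_card']
    congr 1
    ext y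
    simp [Finset.bipartiteAbove]
  · rw [← hB y (by simpa using hy), Set.ncard_eq_toFinset_card']
    congr 1
    ext x
    simp [Finset.bipartiteBelow]

/-! ### Point counts of projective spaces -/

/-- The number of points of a projective space of rank `r` and order `s`. -/
def projCard (s r : ℕ) : ℕ := ∑ i ∈ Finset.range r, s ^ i

@[simp] theorem projCard_zero (s : ℕ) : projCard s 0 = 0 := by simp [projCard]

@[simp] theorem projCard_one (s : ℕ) : projCard s 1 = 1 := by simp [projCard]

theorem projCard_add (s k d : ℕ) : projCard s (k + d) = projCard s k + s ^ k * projCard s d := by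
  simp [projCard, Finset.sum_range_add, pow_add, Finset.mul_sum]

theorem projCard_succ (s r : ℕ) : projCard s (r + 1) = projCard s r + s ^ r := by
  simp [projCard_add]

theorem projCard_succ' (s r : ℕ) : projCard s (r + 1) = 1 + s * projCard s r := by
  rw [add_comm r 1, projCard_add]
  simp

theorem projCard_strictMono {s : ℕ} (hs : 1 < s) : StrictMono (projCard s) :=
  strictMono_nat_of_lt_succ fun r => by
    have : 0 < s ^ r := by positivity
    rw [projCard_succ]
    omega

theorem projCard_lt_pow {s : ℕ} (hs : 1 < s) (r : ℕ) : projCard s r < s ^ r := by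
  induction r with
  | zero => simp
  | succ r ih =>
    rw [projCard_succ, pow_succ]
    nlinarith

theorem projCard_pos {s r : ℕ} (hs : 1 < s) (hr : 0 < r) : 0 < projCard s r := by
  simpa using projCard_strictMono hs hr

/-! ### Cones in projective spaces -/

namespace IsProjectiveSpace

variable {P : Type*} {X : Set P} {𝓛 : Set (Set P)}

theorem line_eq (h : IsProjectiveSpace X 𝓛) {l m : Set P} (hl : l ∈ 𝓛) (hm : m ∈ 𝓛) {p q : P}
    (hpq : p ≠ q) (hpl : p ∈ l) (hql : q ∈ l) (hpm : p ∈ m) (hqm : q ∈ m) : l = m :=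
  (h.existsUnique_line p (h.line_subset l hl hpl) q (h.line_subset l hl hql) hpq).unique
    ⟨hl, hpl, hql⟩ ⟨hm, hpm, hqm⟩

theorem exists_line (h : IsProjectiveSpace X 𝓛) {p q : P} (hp : p ∈ X) (hq : q ∈ X) (hpq : p ≠ q) :
    ∃ l ∈ 𝓛, p ∈ l ∧ q ∈ l :=
  (h.existsUnique_line p hp q hq hpq).exists

/-- The union of `{p}` and the lines that join `p` to a point of `Y`. -/
def cone (𝓛 : Set (Set P)) (Y : Set P) (p : P) : Set P :=
  {x | x = p ∨ ∃ q ∈ Y, ∃ l ∈ 𝓛, p ∈ l ∧ q ∈ l ∧ x ∈ l}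

theorem apex_mem_cone (Y : Set P) (p : P) : p ∈ cone 𝓛 Y p := Or.inl rfl

theorem cone_subset_of_isLineClosed {Y Z : Set P} {p : P} (hpY : p ∉ Y) (hYZ : Y ⊆ Z) (hpZ : p ∈ Z)
    (hZ : IsLineClosed 𝓛 Z) : cone 𝓛 Y p ⊆ Z := by
  rintro x (rfl | ⟨q, hq, l, hl, hpl, hql, hxl⟩)
  · exact hpZ
  · exact hZ l hl p hpl q hql (fun e => hpY (e ▸ hq)) hpZ (hYZ hq) hxl

theorem subset_cone (h : IsProjectiveSpace X 𝓛) {Y : Set P} {p : P} (hYX : Y ⊆ X) (hp : p ∈ X) :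
    Y ⊆ cone 𝓛 Y p := by
  intro q hq
  by_cases e : q = p
  · exact Or.inl e
  · obtain ⟨l, hl, hpl, hql⟩ := h.exists_line hp (hYX hq) (Ne.symm e)
    exact Or.inr ⟨q, hq, l, hl, hpl, hql, hql⟩

theorem cone_subset (h : IsProjectiveSpace X 𝓛) {Y : Set P} {p : P} (hp : p ∈ X) :
    cone 𝓛 Y p ⊆ X := by
  rintro x (rfl | ⟨q, -, l, hl, -, -, hxl⟩)
  · exact hp
  · exact h.line_subset l hl hxl

/-- The main case of line-closedness of a cone: `l` misses the apex, and meets two of its lines. -/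
theorem mem_cone_of_transversal (h : IsProjectiveSpace X 𝓛) {Y : Set P} {p a c x q : P}
    {l la m : Set P} (hp : p ∈ X) (hl : l ∈ 𝓛) (hla : la ∈ 𝓛) (hm : m ∈ 𝓛) (hmY : m ⊆ Y)
    (hpl : p ∉ l) (hpa : p ∈ la) (hal : a ∈ l) (hala : a ∈ la) (hqla : q ∈ la)
    (hqm : q ∈ m) (hcl : c ∈ l) (hcm : c ∈ m) (ham : a ∉ m) (hxl : x ∈ l) :
    x ∈ cone 𝓛 Y p := by
  by_cases hxa : x = a
  · subst hxa
    exact Or.inr ⟨q, hmY hqm, la, hla, hpa, hqla, hala⟩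
  have hxp : p ≠ x := fun e => hpl (e ▸ hxl)
  obtain ⟨k, hk, hpk, hxk⟩ := h.exists_line hp (h.line_subset l hl hxl) hxp
  have hak : a ∉ k := fun hak => hpl (h.line_eq hk hl hxa hxk hak hxl hal ▸ hpk)
  obtain ⟨y, hyk, hym⟩ := h.veblen l hl la hla k hk m hm a (fun e => hpl (e ▸ hpa)) hal hala hak ham
    ⟨x, hxk, hxl⟩ ⟨p, hpk, hpa⟩ ⟨c, hcm, hcl⟩ ⟨q, hqm, hqla⟩
  exact Or.inr ⟨y, hmY hym, k, hk, hpk, hyk, hxk⟩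

/-- A line off the apex that contains two cone points crosses two cone lines. Veblen's axiom at `p`
makes it meet the line `m` of `Y` through their base points; Veblen's axiom at one of the two cone
points then puts each of its points on a line from `p` to `m`. -/
theorem isLineClosed_cone (h : IsProjectiveSpace X 𝓛) {Y : Set P} {p : P} (hYX : Y ⊆ X)
    (hY : IsLineClosed 𝓛 Y) (hp : p ∈ X) (hpY : p ∉ Y) : IsLineClosed 𝓛 (cone 𝓛 Y p) := by
  have apex : ∀ l ∈ 𝓛, ∀ a ∈ l, p ∈ l → a ≠ p → a ∈ cone 𝓛 Y p → l ⊆ cone 𝓛 Y p := by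
    rintro l hl a hal hpl hap (e | ⟨q, hq, m, hm, hpm, hqm, ham⟩)
    · exact absurd e hap
    · have := h.line_eq hl hm hap hal hpl ham hpm
      subst this
      exact fun x hx => Or.inr ⟨q, hq, l, hl, hpm, hqm, hx⟩
  intro l hl a hal b hbl hab ha hb
  by_cases hpl : p ∈ l
  · by_cases hap : a = p
    · exact apex l hl b hbl hpl (fun e => hab (hap.trans e.symm)) hb
    · exact apex l hl a hal hpl hap ha
  obtain e | ⟨q, hq, la, hla, hpa, hqa, hala⟩ := ha
  · exact absurd (e ▸ hal) hpl
  obtain e | ⟨r, hr, lb, hlb, hpb, hrb, hblb⟩ := hb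
  · exact absurd (e ▸ hbl) hpl
  have hne : la ≠ lb := fun e => by
    subst e
    exact hpl (h.line_eq hl hla hab hal hbl hala hblb ▸ hpa)
  have hqr : q ≠ r := fun e => by
    subst e
    exact hne (h.line_eq hla hlb (fun e : p = q => hpY (e ▸ hq)) hpa hqa hpb hrb)
  obtain ⟨m, hm, hqm, hrm⟩ := h.exists_line (hYX hq) (hYX hr) hqr
  have hmY : m ⊆ Y := hY m hm q hqm r hrm hqr hq hr
  obtain ⟨c, hcl, hcm⟩ := h.veblen la hla lb hlb l hl m hm p hne hpa hpb hpl
    (fun hpm => hpY (hmY hpm)) ⟨a, hal, hala⟩ ⟨b, hbl, hblb⟩ ⟨q, hqm, hqa⟩ ⟨r, hrm, hrb⟩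
  -- Veblen's axiom has to be applied at a point off `m`. If neither `a` nor `b` is one, then `l =
  -- m` lies in `Y`.
  by_cases ham : a ∈ m
  · by_cases hbm : b ∈ m
    · exact (h.line_eq hl hm hab hal hbl ham hbm ▸ hmY).trans (h.subset_cone hYX hp)
    · exact fun x => h.mem_cone_of_transversal hp hl hlb hm hmY hpl hpb hbl hblb hrb hrm hcl hcm
        hbm
  · exact fun x => h.mem_cone_of_transversal hp hl hla hm hmY hpl hpa hal hala hqa hqm hcl hcm
      ham

/-- A line through `p` meets `Y` at most once, since otherwise it would lie in `Y`. So the points of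
`Y` partition the cone minus its apex into sets of `s` points. -/
theorem ncard_cone [Finite P] (h : IsProjectiveSpace X 𝓛) {s : ℕ} (hs : ∀ l ∈ 𝓛, l.ncard = s + 1)
    {Y : Set P} {p : P} (hYX : Y ⊆ X) (hY : IsLineClosed 𝓛 Y) (hp : p ∈ X) (hpY : p ∉ Y) :
    (cone 𝓛 Y p).ncard = 1 + s * Y.ncard := by
  have key := Set.ncard_mul_eq_ncard_mul_of_biregular (cone 𝓛 Y p \ {p}) Y
    (fun x q => ∃ l ∈ 𝓛, p ∈ l ∧ q ∈ l ∧ x ∈ l) (a := 1) (b := s) ?_ ?_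
  · have := Set.ncard_sdiff_singleton_add_one (apex_mem_cone (𝓛 := 𝓛) Y p)
    rw [← this, mul_comm s, ← key]
    ring
  · rintro x ⟨e | ⟨q, hq, l, hl, hpl, hql, hxl⟩, hxp⟩
    · exact absurd e hxp
    rw [Set.ncard_eq_one]
    refine ⟨q, Set.eq_singleton_iff_unique_mem.2 ⟨⟨hq, l, hl, hpl, hql, hxl⟩, ?_⟩⟩
    rintro r ⟨hr, m, hm, hpm, hrm, hxm⟩
    have := h.line_eq hl hm hxp hxl hpl hxm hpm
    subst this
    by_contra hrq
    exact hpY (hY l hl r hrm q hql hrq hr hq hpl)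
  · intro q hq
    have hpq : p ≠ q := fun e => hpY (e ▸ hq)
    obtain ⟨l, hl, hpl, hql⟩ := h.exists_line hp (hYX hq) hpq
    have hset : {x | x ∈ cone 𝓛 Y p \ {p} ∧ ∃ l ∈ 𝓛, p ∈ l ∧ q ∈ l ∧ x ∈ l} = l \ {p} := by
      ext x
      constructor
      · rintro ⟨⟨-, hxp⟩, m, hm, hpm, hqm, hxm⟩
        exact ⟨h.line_eq hl hm hpq hpl hql hpm hqm ▸ hxm, hxp⟩
      · rintro ⟨hxl, hxp⟩
        exact ⟨⟨Or.inr ⟨q, hq, l, hl, hpl, hql, hxl⟩, hxp⟩, l, hl, hpl, hql, hxl⟩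
    rw [hset, Set.ncard_sdiff_singleton_of_mem hpl, hs l hl]
    rfl

end IsProjectiveSpace

/-! ### Rank as cardinality, and counting inside a singular subspace -/

namespace PolarSpace

variable {P : Type*} {n s : ℕ} {Δ : PolarSpace P n} {X Y V : Set P} {k m : ℕ}

/-- The axioms provide only some line family on `X`; its members have rank 2, so the order
hypothesis applies to them. -/
theorem exists_lines (hX : X ∈ Δ.subspaces) : ∃ 𝓛 : Set (Set P), IsProjectiveSpace X 𝓛 ∧
    (∀ Y, Y ⊆ X → (Y ∈ Δ.subspaces ↔ IsLineClosed 𝓛 Y)) ∧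
    ∀ l ∈ 𝓛, HasRank Δ.subspaces l 2 := by
  classical
  obtain ⟨𝓛, h, hsub⟩ := Δ.projective X hX
  refine ⟨𝓛, h, hsub, fun l hl => ?_⟩
  obtain ⟨a, ha, b, hb, -, -, hab, -, -⟩ := h.three_points l hl
  have hlX := h.line_subset l hl
  refine ⟨(hsub l hlX).2 fun m hm p hpm q hqm hpq hpl hql =>
    (h.line_eq hm hl hpq hpm hqm hpl hql).subset, ⟨{a, b}, Finset.card_pair hab, ?_, ?_⟩, ?_⟩
  · simp [Set.insert_subset_iff, ha, hb]
  · intro Y hY habY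
    have hY' := (hsub _ Set.inter_subset_right).1 (Δ.inter_mem Y hY X hX)
    exact (hY' l hl a ha b hb hab ⟨habY (by simp), hlX ha⟩ ⟨habY (by simp), hlX hb⟩).trans
      Set.inter_subset_left
  · rintro k ⟨S, rfl, hSl, hS⟩
    -- Fewer than two points lie in a singleton, which is vacuously line-closed and so cannot
    -- contain both `a` and `b`.
    by_contra! hlt
    obtain ⟨c, hcX, hc⟩ : ∃ c ∈ X, (S : Set P) ⊆ {c} := by
      rcases S.eq_empty_or_nonempty with rfl | ⟨c, hc⟩
      · exact ⟨a, hlX ha, by simp⟩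
      · exact ⟨c, hlX (hSl hc), fun x hx => Finset.card_le_one.1 (by omega) x hx c hc⟩
    have hcl := hS {c} ((hsub _ (by simpa using hcX)).2 fun m hm p _ q _ hpq hp hq =>
      absurd (hp.trans hq.symm) hpq) hc
    exact hab ((hcl ha).trans (hcl hb).symm)

theorem empty_mem : ∅ ∈ Δ.subspaces := by
  obtain ⟨V, -, hV, -, -⟩ := Δ.exists_disjoint
  obtain ⟨𝓛, -, hsub, -⟩ := exists_lines hV.1
  exact (hsub _ (Set.empty_subset _)).2 fun l _ p _ q _ _ hp => absurd hp (Set.notMem_empty p)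

theorem exists_joining_line (hX : X ∈ Δ.subspaces) {p q : P} (hp : p ∈ X) (hq : q ∈ X)
    (hpq : p ≠ q) : ∃ l, HasRank Δ.subspaces l 2 ∧ p ∈ l ∧ q ∈ l := by
  obtain ⟨𝓛, h, -, hline⟩ := exists_lines hX
  obtain ⟨l, hl, hpl, hql⟩ := h.exists_line hp hq hpq
  exact ⟨l, hline l hl, hpl, hql⟩

variable [Finite P]

/-- The subspace generated by a subspace `Y` and a point `p` of a subspace containing `Y`. -/
theorem exists_adjoin_point (hs : ∀ l ∈ Δ.ofDim 1, l.ncard = s + 1) (hX : X ∈ Δ.subspaces)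
    (hY : Y ∈ Δ.subspaces) (hYX : Y ⊆ X) {p : P} (hp : p ∈ X) (hpY : p ∉ Y) :
    ∃ Z ∈ Δ.subspaces, Y ⊆ Z ∧ p ∈ Z ∧ Z ⊆ X ∧ Z.ncard = 1 + s * Y.ncard ∧
      ∀ Z' ∈ Δ.subspaces, Y ⊆ Z' → p ∈ Z' → Z ⊆ Z' := by
  obtain ⟨𝓛, h, hsub, hline⟩ := exists_lines hX
  have hYc := (hsub Y hYX).1 hY
  refine ⟨IsProjectiveSpace.cone 𝓛 Y p, (hsub _ (h.cone_subset hp)).2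
    (h.isLineClosed_cone hYX hYc hp hpY), h.subset_cone hYX hp, IsProjectiveSpace.apex_mem_cone _ _,
    h.cone_subset hp, h.ncard_cone (fun l hl => hs l (hline l hl)) hYX hYc hp hpY, ?_⟩
  intro Z' hZ' hYZ' hpZ'
  exact (IsProjectiveSpace.cone_subset_of_isLineClosed hpY (Set.subset_inter hYZ' hYX) ⟨hpZ', hp⟩
    ((hsub _ Set.inter_subset_right).1 (Δ.inter_mem Z' hZ' X hX))).trans Set.inter_subset_left

/-- Greedy extension of a basis: adjoining a point replaces |Y| by 1 + s|Y|, the recursion satisfied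
by `projCard`. -/
theorem exists_generates_of_subset (hs : ∀ l ∈ Δ.ofDim 1, l.ncard = s + 1) (hX : X ∈ Δ.subspaces)
    (hY : Y ∈ Δ.subspaces) (hYX : Y ⊆ X) (S : Finset P) (hS : Generates Δ.subspaces (S : Set P) Y)
    (hYS : Y.ncard = projCard s S.card) :
    ∃ T : Finset P, Generates Δ.subspaces (T : Set P) X ∧ X.ncard = projCard s T.card := by
  classical
  induction hd : X.ncard - Y.ncard using Nat.strong_induction_on generalizing Y S with
  | _ d ih =>
    by_cases hXY : X ⊆ Y
    · obtain rfl := hYX.antisymm hXY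
      exact ⟨S, hS, hYS⟩
    obtain ⟨p, hp, hpY⟩ := Set.not_subset.1 hXY
    obtain ⟨Z, hZ, hYZ, hpZ, hZX, hcard, hmin⟩ := exists_adjoin_point hs hX hY hYX hp hpY
    have hlt : Y.ncard < Z.ncard :=
      Set.ncard_lt_ncard (hYZ.ssubset_of_not_subset fun h => hpY (h hpZ))
    have hle : Z.ncard ≤ X.ncard := Set.ncard_le_ncard hZX
    have hpS : p ∉ S := fun h => hpY (hS.1 h)
    refine ih (X.ncard - Z.ncard) (by omega) hZ hZX (insert p S) ⟨?_, ?_⟩ ?_ rfl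
    · rw [Finset.coe_insert]
      exact Set.insert_subset hpZ (hS.1.trans hYZ)
    · intro W hW hSW
      rw [Finset.coe_insert, Set.insert_subset_iff] at hSW
      exact hmin W hW (hS.2 W hW hSW.2) hSW.1
    · rw [hcard, Finset.card_insert_of_notMem hpS, projCard_succ', hYS]

theorem exists_generates (hs : ∀ l ∈ Δ.ofDim 1, l.ncard = s + 1) (hX : X ∈ Δ.subspaces) :
    ∃ T : Finset P, Generates Δ.subspaces (T : Set P) X ∧ X.ncard = projCard s T.card :=
  exists_generates_of_subset hs hX empty_mem (Set.empty_subset X) ∅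
    ⟨by simp, fun _ _ _ => Set.empty_subset _⟩ (by simp)

theorem exists_subspace_ncard_le (hs : ∀ l ∈ Δ.ofDim 1, l.ncard = s + 1)
    (hX : X ∈ Δ.subspaces) (S : Finset P) (hSX : (S : Set P) ⊆ X) :
    ∃ Z ∈ Δ.subspaces, (S : Set P) ⊆ Z ∧ Z ⊆ X ∧ Z.ncard ≤ projCard s S.card := by
  classical
  induction S using Finset.induction_on with
  | empty => exact ⟨∅, empty_mem, by simp, by simp, by simp⟩
  | insert p S hpS ih =>
    rw [Finset.coe_insert, Set.insert_subset_iff] at hSX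
    obtain ⟨Z, hZ, hSZ, hZX, hcard⟩ := ih hSX.2
    rw [Finset.card_insert_of_notMem hpS, Finset.coe_insert]
    by_cases hpZ : p ∈ Z
    · exact ⟨Z, hZ, Set.insert_subset hpZ hSZ, hZX,
        hcard.trans ((projCard_succ s _).symm ▸ Nat.le_add_right _ _)⟩
    · obtain ⟨W, hW, hZW, hpW, hWX, hWcard, -⟩ := exists_adjoin_point hs hX hZ hZX hSX.1 hpZ
      refine ⟨W, hW, Set.insert_subset hpW (hSZ.trans hZW), hWX, ?_⟩
      rw [hWcard, projCard_succ']
      gcongr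

/-- A greedy generating set attains |X| = [r], while any generating set of size k forces |X| ≤ [k].
Strict monotonicity of [r] identifies the minimum. -/
theorem hasRank_iff (hs : ∀ l ∈ Δ.ofDim 1, l.ncard = s + 1) (hs1 : 1 < s) {r : ℕ} :
    HasRank Δ.subspaces X r ↔ X ∈ Δ.subspaces ∧ X.ncard = projCard s r := by
  have key : ∀ X ∈ Δ.subspaces, ∀ S : Finset P, Generates Δ.subspaces (S : Set P) X →
      X.ncard ≤ projCard s S.card := fun X hX S hS => by
    obtain ⟨Z, hZ, hSZ, -, hcard⟩ := exists_subspace_ncard_le hs hX S hS.1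
    exact (Set.ncard_le_ncard (hS.2 Z hZ hSZ)).trans hcard
  have mono := projCard_strictMono hs1
  constructor
  · rintro ⟨hX, ⟨S, rfl, hS⟩, hleast⟩
    refine ⟨hX, (key X hX S hS).antisymm ?_⟩
    obtain ⟨T, hT, hcard⟩ := exists_generates hs hX
    rw [hcard]
    exact mono.monotone (hleast ⟨T, rfl, hT⟩)
  · rintro ⟨hX, hcard⟩
    obtain ⟨T, hT, hT'⟩ := exists_generates hs hX
    refine ⟨hX, ⟨T, mono.injective (hT'.symm.trans hcard), hT⟩, ?_⟩
    rintro k ⟨S, rfl, hS⟩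
    exact mono.le_iff_le.1 (hcard ▸ key X hX S hS)


theorem exists_hasRank_succ (hs : ∀ l ∈ Δ.ofDim 1, l.ncard = s + 1) (hs1 : 1 < s)
    (hX : HasRank Δ.subspaces X k) (hV : V ∈ Δ.subspaces) (hXV : X ⊆ V) {p : P}
    (hp : p ∈ V) (hpX : p ∉ X) : ∃ Z, HasRank Δ.subspaces Z (k + 1) ∧ X ⊆ Z ∧ p ∈ Z ∧ Z ⊆ V ∧
      ∀ Z' ∈ Δ.subspaces, X ⊆ Z' → p ∈ Z' → Z ⊆ Z' := by
  obtain ⟨Z, hZ, hXZ, hpZ, hZV, hcard, hmin⟩ := exists_adjoin_point hs hV hX.1 hXV hp hpX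
  refine ⟨Z, (hasRank_iff hs hs1).2 ⟨hZ, ?_⟩, hXZ, hpZ, hZV, hmin⟩
  rw [hcard, ((hasRank_iff hs hs1).1 hX).2, projCard_succ']

theorem eq_of_subset_of_hasRank (hs : ∀ l ∈ Δ.ofDim 1, l.ncard = s + 1) (hs1 : 1 < s)
    (hX : HasRank Δ.subspaces X k) (hY : HasRank Δ.subspaces Y k) (hXY : X ⊆ Y) : X = Y :=
  Set.eq_of_subset_of_ncard_le hXY
    (((hasRank_iff hs hs1).1 hY).2.trans ((hasRank_iff hs hs1).1 hX).2.symm).le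

theorem rank_le_of_subset (hs : ∀ l ∈ Δ.ofDim 1, l.ncard = s + 1) (hs1 : 1 < s)
    (hX : HasRank Δ.subspaces X k) (hY : HasRank Δ.subspaces Y m) (hXY : X ⊆ Y) : k ≤ m := by
  rw [← (projCard_strictMono hs1).le_iff_le, ← ((hasRank_iff hs hs1).1 hX).2,
    ← ((hasRank_iff hs hs1).1 hY).2]
  exact Set.ncard_le_ncard hXY

theorem rank_lt_of_ssubset (hs : ∀ l ∈ Δ.ofDim 1, l.ncard = s + 1) (hs1 : 1 < s)
    (hX : HasRank Δ.subspaces X k) (hY : HasRank Δ.subspaces Y m) (hXY : X ⊂ Y) : k < m := by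
  refine (rank_le_of_subset hs hs1 hX hY hXY.subset).lt_of_ne ?_
  rintro rfl
  exact hXY.ne (eq_of_subset_of_hasRank hs hs1 hX hY hXY.subset)

theorem ncard_diff_of_hasRank (hs : ∀ l ∈ Δ.ofDim 1, l.ncard = s + 1) (hs1 : 1 < s) {d : ℕ}
    (hX : HasRank Δ.subspaces X k) (hY : HasRank Δ.subspaces Y (k + d)) (hXY : X ⊆ Y) :
    (Y \ X).ncard = s ^ k * projCard s d := by
  rw [Set.ncard_sdiff hXY, ((hasRank_iff hs hs1).1 hX).2, ((hasRank_iff hs hs1).1 hY).2,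
    projCard_add, Nat.add_sub_cancel_left]

/-- A subspace of rank `k` in a subspace `V` of rank `k + d` is covered by `projCard s d` subspaces
of `V`. -/
theorem ncard_covers_within (hs : ∀ l ∈ Δ.ofDim 1, l.ncard = s + 1) (hs1 : 1 < s) {d : ℕ}
    (hX : HasRank Δ.subspaces X k) (hV : HasRank Δ.subspaces V (k + d)) (hXV : X ⊆ V) :
    {Y | HasRank Δ.subspaces Y (k + 1) ∧ X ⊆ Y ∧ Y ⊆ V}.ncard = projCard s d := by
  -- Each point of `V \ X` spans a unique cover with `X`, and each cover has `s ^ k` points off `X`.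
  have key := Set.ncard_mul_eq_ncard_mul_of_biregular (V \ X)
    {Y | HasRank Δ.subspaces Y (k + 1) ∧ X ⊆ Y ∧ Y ⊆ V} (· ∈ ·) (a := 1) (b := s ^ k) ?_ ?_
  · rw [ncard_diff_of_hasRank hs hs1 hX hV hXV, mul_one, mul_comm] at key
    exact (Nat.eq_of_mul_eq_mul_right (by positivity) key).symm
  · rintro p ⟨hp, hpX⟩
    obtain ⟨Z, hZ, hXZ, hpZ, hZV, hmin⟩ := exists_hasRank_succ hs hs1 hX hV.1 hXV hp hpX
    rw [Set.ncard_eq_one]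
    refine ⟨Z, Set.eq_singleton_iff_unique_mem.2 ⟨⟨⟨hZ, hXZ, hZV⟩, hpZ⟩, ?_⟩⟩
    rintro Y ⟨⟨hY, hXY, -⟩, hpY⟩
    exact (eq_of_subset_of_hasRank hs hs1 hZ hY (hmin Y hY.1 hXY hpY)).symm
  · rintro Y ⟨hY, hXY, hYV⟩
    have hset : {p | p ∈ V \ X ∧ p ∈ Y} = Y \ X := by
      ext p
      exact ⟨fun h => ⟨h.2, h.1.2⟩, fun h => ⟨⟨hYV h.1, h.2⟩, h.1⟩⟩
    rw [hset, ncard_diff_of_hasRank hs hs1 hX hY hXY]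
    simp

/-- A subspace of rank `k` in a subspace `V` of rank `m + 1` is in `projCard s (m + 1 - k)`
hyperplanes of `V`. -/
theorem ncard_hyperplanes_within (hs : ∀ l ∈ Δ.ofDim 1, l.ncard = s + 1) (hs1 : 1 < s) {d : ℕ}
    (hX : HasRank Δ.subspaces X k) (hV : HasRank Δ.subspaces V (m + 1)) (hXV : X ⊆ V)
    (hkd : k + d = m + 1) :
    {H | HasRank Δ.subspaces H m ∧ X ⊆ H ∧ H ⊆ V}.ncard = projCard s d := by
  induction d generalizing k X with
  | zero =>
    obtain rfl : k = m + 1 := hkd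
    rw [projCard_zero, Set.ncard_eq_zero, Set.eq_empty_iff_forall_notMem]
    rintro H ⟨hH, hXH, -⟩
    have := rank_le_of_subset hs hs1 hX hH hXH
    omega
  | succ d ih =>
    -- The case where `X` is itself a hyperplane is separate: the factor to be cancelled below would
    -- be [0] = 0.
    obtain _ | d := d
    · obtain rfl : k = m := by omega
      rw [zero_add, projCard_one, Set.ncard_eq_one]
      refine ⟨X, Set.eq_singleton_iff_unique_mem.2 ⟨⟨hX, subset_rfl, hXV⟩, ?_⟩⟩
      rintro H ⟨hH, hXH, -⟩
      exact (eq_of_subset_of_hasRank hs hs1 hX hH hXH).symm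
    -- Hyperplanes containing `X` and `p` are those containing their span, of rank `k + 1`, so the
    -- induction hypothesis counts them.
    have key := Set.ncard_mul_eq_ncard_mul_of_biregular (V \ X)
      {H | HasRank Δ.subspaces H m ∧ X ⊆ H ∧ H ⊆ V} (· ∈ ·) (a := projCard s (d + 1))
      (b := s ^ k * projCard s (d + 1)) ?_ ?_
    · have hV' : HasRank Δ.subspaces V (k + (d + 1 + 1)) := hkd.symm ▸ hV
      rw [ncard_diff_of_hasRank hs hs1 hX hV' hXV, mul_right_comm, mul_comm] at key
      have := projCard_pos hs1 (Nat.succ_pos d)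
      exact (Nat.eq_of_mul_eq_mul_right (by positivity) key).symm
    · rintro p ⟨hp, hpX⟩
      obtain ⟨Z, hZ, hXZ, hpZ, hZV, hmin⟩ := exists_hasRank_succ hs hs1 hX hV.1 hXV hp hpX
      rw [← ih hZ hZV (by omega)]
      congr 1
      ext H
      exact ⟨fun h => ⟨h.1.1, hmin H h.1.1.1 h.1.2.1 h.2, h.1.2.2⟩,
        fun h => ⟨⟨h.1, hXZ.trans h.2.1, h.2.2⟩, h.2.1 hpZ⟩⟩
    · rintro H ⟨hH, hXH, hHV⟩
      have hset : {p | p ∈ V \ X ∧ p ∈ H} = H \ X := by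
        ext p
        exact ⟨fun h => ⟨h.2, h.1.2⟩, fun h => ⟨⟨hHV h.1, h.2⟩, h.1⟩⟩
      have hH' : HasRank Δ.subspaces H (k + (d + 1)) := (by omega : m = k + (d + 1)) ▸ hH
      rw [hset, ncard_diff_of_hasRank hs hs1 hX hH' hXH]

/-- Tits' `W` has rank `n` because it properly contains the rank `n - 1` subspace `V ∩ W`. It
contains `V ∩ X` because the points of `V ∩ X` are joined to `p` by lines of `X`. -/
theorem exists_hasRank_top_of_mem_inter (hs : ∀ l ∈ Δ.ofDim 1, l.ncard = s + 1) (hs1 : 1 < s)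
    (hn : 0 < n) (hX : X ∈ Δ.subspaces) (hV : HasRank Δ.subspaces V n) {p : P} (hp : p ∈ X)
    (hpV : p ∉ V) : ∃ W, HasRank Δ.subspaces W n ∧ p ∈ W ∧ V ∩ X ⊆ W ∧
      HasRank Δ.subspaces (V ∩ W) (n - 1) := by
  obtain ⟨W, ⟨hW, hpW, hVW⟩, -⟩ := Δ.existsUnique_subspace V hV p hpV
  refine ⟨W, ?_, hpW, ?_, hVW⟩
  · obtain ⟨r, hr, hWr⟩ := Δ.rank_le W hW
    have := rank_lt_of_ssubset hs hs1 hVW hWr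
      (Set.inter_subset_right.ssubset_of_not_subset fun h => hpV (h hpW).1)
    exact (by omega : r = n) ▸ hWr
  · rintro q ⟨hqV, hqX⟩
    exact Δ.mem_of_joined V hV p hpV W hW hpW hVW q hqV
      (exists_joining_line hX hp hqX fun e => hpV (e ▸ hqV))

/-- For a top subspace `V` with |V ∩ X| maximal, a point of `X` off `V` would yield one meeting `X`
in more points. -/
theorem exists_hasRank_top (hs : ∀ l ∈ Δ.ofDim 1, l.ncard = s + 1) (hs1 : 1 < s) (hn : 0 < n)
    (hX : X ∈ Δ.subspaces) : ∃ V, HasRank Δ.subspaces V n ∧ X ⊆ V := by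
  obtain ⟨V₀, -, hV₀, -, -⟩ := Δ.exists_disjoint
  obtain ⟨V, hV, hmax⟩ := Set.exists_max_image {V | HasRank Δ.subspaces V n}
    (fun V => (V ∩ X).ncard) (Set.toFinite _) ⟨V₀, hV₀⟩
  refine ⟨V, hV, fun p hp => by_contra fun hpV => ?_⟩
  obtain ⟨W, hW, hpW, hVW, -⟩ := exists_hasRank_top_of_mem_inter hs hs1 hn hX hV hp hpV
  refine (hmax W hW).not_gt (Set.ncard_lt_ncard ?_)
  exact (Set.subset_inter hVW Set.inter_subset_right).ssubset_of_not_subset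
    fun h => hpV (h ⟨hpW, hp⟩).1

end PolarSpace

/-! ### Covers of a singular subspace and the recursion for N_k -/

namespace PolarSpace

variable {P : Type*} [Finite P] {n s t : ℕ} {Δ : PolarSpace P n} {X V : Set P} {k : ℕ}

/-- Another top subspace through `H` meets `V` in rank at least `n - 1` and below `n`, hence exactly
in `H`. Only `V` is removed from the `t + 1`. -/
theorem HasOrder.ncard_tops_over_hyperplane (hΔ : Δ.HasOrder s t) (hs1 : 1 < s) (hn : 1 < n)
    {H : Set P} (hH : HasRank Δ.subspaces H (n - 1)) (hV : HasRank Δ.subspaces V n) (hHV : H ⊆ V) :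
    {W | HasRank Δ.subspaces W n ∧ V ∩ W = H}.ncard = t := by
  have h1 : n - 1 + 1 = n := by omega
  have h2 : n - 1 = n - 2 + 1 := by omega
  have hset : {W | HasRank Δ.subspaces W n ∧ V ∩ W = H} =
      {Y | Y ∈ Δ.ofDim (n - 1) ∧ H ⊆ Y} \ {V} := by
    ext W
    simp only [ofDim, h1, Set.mem_ofPred_eq, Set.mem_sdiff, Set.mem_singleton_iff]
    constructor
    · rintro ⟨hW, rfl⟩
      refine ⟨⟨hW, Set.inter_subset_right⟩, ?_⟩
      rintro rfl
      rw [Set.inter_self] at hH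
      have := rank_le_of_subset hΔ.1 hs1 hV hH subset_rfl
      omega
    · rintro ⟨⟨hW, hHW⟩, hne⟩
      refine ⟨hW, ?_⟩
      have hVW := Δ.inter_mem V hV.1 W hW.1
      obtain ⟨r, -, hr⟩ := Δ.rank_le _ hVW
      have h2 := rank_le_of_subset hΔ.1 hs1 hH hr (Set.subset_inter hHV hHW)
      have h3 : r < n := rank_lt_of_ssubset hΔ.1 hs1 hr hV
        (Set.inter_subset_left.ssubset_of_not_subset fun h =>
          hne (eq_of_subset_of_hasRank hΔ.1 hs1 hV hW (h.trans Set.inter_subset_right)).symm)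
      obtain rfl : n - 1 = r := by omega
      exact (eq_of_subset_of_hasRank hΔ.1 hs1 hH hr (Set.subset_inter hHV hHW)).symm
  have hVmem : V ∈ {Y | Y ∈ Δ.ofDim (n - 1) ∧ H ⊆ Y} :=
    ⟨(h1.symm ▸ hV : HasRank Δ.subspaces V (n - 1 + 1)), hHV⟩
  have hH' : H ∈ Δ.ofDim (n - 2) := (h2 ▸ hH : HasRank Δ.subspaces H (n - 2 + 1))
  rw [hset, Set.ncard_sdiff_singleton_of_mem hVmem, hΔ.2 H hH', Nat.add_sub_cancel]

/-- The subspaces of top rank that meet `V` in a hyperplane containing `X`. -/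
theorem HasOrder.ncard_tops_adjacent (hΔ : Δ.HasOrder s t) (hs1 : 1 < s) (hn : 1 < n) {d : ℕ}
    (hX : HasRank Δ.subspaces X k) (hV : HasRank Δ.subspaces V n) (hXV : X ⊆ V) (hkd : k + d = n) :
    {W | HasRank Δ.subspaces W n ∧ HasRank Δ.subspaces (V ∩ W) (n - 1) ∧ X ⊆ W}.ncard =
      projCard s d * t := by
  have key := Set.ncard_mul_eq_ncard_mul_of_biregular
    {W | HasRank Δ.subspaces W n ∧ HasRank Δ.subspaces (V ∩ W) (n - 1) ∧ X ⊆ W}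
    {H | HasRank Δ.subspaces H (n - 1) ∧ X ⊆ H ∧ H ⊆ V} (fun W H => V ∩ W = H)
    (a := 1) (b := t) ?_ ?_
  · have h1 : n = n - 1 + 1 := by omega
    rwa [mul_one, ncard_hyperplanes_within hΔ.1 hs1 hX (h1 ▸ hV) hXV (hkd.trans h1)] at key
  · rintro W ⟨-, hVW, hXW⟩
    rw [Set.ncard_eq_one]
    refine ⟨V ∩ W, Set.eq_singleton_iff_unique_mem.2
      ⟨⟨⟨hVW, Set.subset_inter hXV hXW, Set.inter_subset_left⟩, rfl⟩, ?_⟩⟩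
    rintro H ⟨-, h⟩
    exact h.symm
  · rintro H ⟨hH, hXH, hHV⟩
    rw [← hΔ.ncard_tops_over_hyperplane hs1 hn hH hV hHV]
    congr 1
    ext W
    constructor
    · exact fun h => ⟨h.1.1, h.2⟩
    · rintro ⟨hW, rfl⟩
      exact ⟨⟨hW, hH, hXH.trans Set.inter_subset_right⟩, rfl⟩

/-- The covers of `X` that are not in a given subspace `V` of top rank containing `X`. -/
theorem HasOrder.ncard_covers_outside (hΔ : Δ.HasOrder s t) (hs1 : 1 < s) (hn : 1 < n) {d : ℕ}
    (hX : HasRank Δ.subspaces X k) (hV : HasRank Δ.subspaces V n) (hXV : X ⊆ V)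
    (hkd : k + (d + 1) = n) :
    {Y | HasRank Δ.subspaces Y (k + 1) ∧ X ⊆ Y ∧ ¬ Y ⊆ V}.ncard =
      projCard s (d + 1) * t * s ^ d := by
  rw [← hΔ.ncard_tops_adjacent hs1 hn hX hV hXV hkd, eq_comm,
    ← mul_one {Y | HasRank Δ.subspaces Y (k + 1) ∧ X ⊆ Y ∧ ¬ Y ⊆ V}.ncard]
  -- Each adjacent `W` contributes [d+1] - [d] = s^d covers, those in `W` but not in `V ∩ W`. Each
  -- cover `Y` lies in one `W` only, by Tits' axiom at a point of `Y` off `V`.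
  refine Set.ncard_mul_eq_ncard_mul_of_biregular _ _ (fun W Y => Y ⊆ W) ?_ ?_
  · rintro W ⟨hW, hVW, hXW⟩
    have hset : {Y | Y ∈ {Y | HasRank Δ.subspaces Y (k + 1) ∧ X ⊆ Y ∧ ¬ Y ⊆ V} ∧ Y ⊆ W} =
        {Y | HasRank Δ.subspaces Y (k + 1) ∧ X ⊆ Y ∧ Y ⊆ W} \
          {Y | HasRank Δ.subspaces Y (k + 1) ∧ X ⊆ Y ∧ Y ⊆ V ∩ W} := by
      ext Y
      simp only [Set.mem_ofPred_eq, Set.mem_sdiff, Set.subset_inter_iff]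
      tauto
    have hW' : HasRank Δ.subspaces W (k + (d + 1)) := hkd.symm ▸ hW
    have hVW' : HasRank Δ.subspaces (V ∩ W) (k + d) := (by omega : n - 1 = k + d) ▸ hVW
    have hsub : {Y | HasRank Δ.subspaces Y (k + 1) ∧ X ⊆ Y ∧ Y ⊆ V ∩ W} ⊆
        {Y | HasRank Δ.subspaces Y (k + 1) ∧ X ⊆ Y ∧ Y ⊆ W} :=
      fun Y h => ⟨h.1, h.2.1, h.2.2.trans Set.inter_subset_right⟩
    rw [hset, Set.ncard_sdiff hsub,
      ncard_covers_within hΔ.1 hs1 hX hW' hXW,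
      ncard_covers_within hΔ.1 hs1 hX hVW' (Set.subset_inter hXV hXW), projCard_succ,
      Nat.add_sub_cancel_left]
  · rintro Y ⟨hY, hXY, hYV⟩
    obtain ⟨p, hpY, hpV⟩ := Set.not_subset.1 hYV
    have hpX : p ∉ X := fun h => hpV (hXV h)
    obtain ⟨W, hW, hpW, hVYW, hVW⟩ :=
      exists_hasRank_top_of_mem_inter hΔ.1 hs1 (by omega) hY.1 hV hpY hpV
    have hXW : X ⊆ W := (Set.subset_inter hXV hXY).trans hVYW
    obtain ⟨Z, hZ, -, -, hZY, hmin⟩ := exists_hasRank_succ hΔ.1 hs1 hX hY.1 hXY hpY hpX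
    obtain rfl := eq_of_subset_of_hasRank hΔ.1 hs1 hZ hY hZY
    rw [Set.ncard_eq_one]
    refine ⟨W, Set.eq_singleton_iff_unique_mem.2
      ⟨⟨⟨hW, hVW, hXW⟩, hmin W hW.1 hXW hpW⟩, ?_⟩⟩
    rintro W' ⟨⟨hW', hVW', -⟩, hYW'⟩
    exact (Δ.existsUnique_subspace V hV p hpV).unique ⟨hW'.1, hYW' hpY, hVW'⟩ ⟨hW.1, hpW, hVW⟩

theorem HasOrder.ncard_covers (hΔ : Δ.HasOrder s t) (hs1 : 1 < s) (hn : 1 < n) {d : ℕ}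
    (hX : HasRank Δ.subspaces X k) (hkd : k + (d + 1) = n) :
    {Y | HasRank Δ.subspaces Y (k + 1) ∧ X ⊆ Y}.ncard =
      projCard s (d + 1) * (1 + t * s ^ d) := by
  obtain ⟨V, hV, hXV⟩ := exists_hasRank_top hΔ.1 hs1 (by omega) hX.1
  have hset : {Y | HasRank Δ.subspaces Y (k + 1) ∧ X ⊆ Y} =
      {Y | HasRank Δ.subspaces Y (k + 1) ∧ X ⊆ Y ∧ Y ⊆ V} ∪
        {Y | HasRank Δ.subspaces Y (k + 1) ∧ X ⊆ Y ∧ ¬ Y ⊆ V} := by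
    ext Y
    simp only [Set.mem_ofPred_eq, Set.mem_union]
    tauto
  have hV' : HasRank Δ.subspaces V (k + (d + 1)) := hkd.symm ▸ hV
  rw [hset, Set.ncard_union_eq (Set.disjoint_left.2 fun Y h h' => h'.2.2 h.2.2),
    ncard_covers_within hΔ.1 hs1 hX hV' hXV, hΔ.ncard_covers_outside hs1 hn hX hV hXV hkd]
  ring

/-- The number of subspaces of rank `k`, by recursion on `k`. -/
theorem HasOrder.ncard_hasRank_succ_mul (hΔ : Δ.HasOrder s t) (hs1 : 1 < s) (hn : 1 < n) {d : ℕ}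
    (hkd : k + (d + 1) = n) :
    {Y | HasRank Δ.subspaces Y (k + 1)}.ncard * projCard s (k + 1) =
      {X | HasRank Δ.subspaces X k}.ncard * (projCard s (d + 1) * (1 + t * s ^ d)) := by
  refine (Set.ncard_mul_eq_ncard_mul_of_biregular {X | HasRank Δ.subspaces X k}
    {Y | HasRank Δ.subspaces Y (k + 1)} (· ⊆ ·) ?_ ?_).symm
  · exact fun X hX => hΔ.ncard_covers hs1 hn hX hkd
  · intro Y hY
    -- The rank `k` subspaces of `Y` are its hyperplanes over the empty subspace.
    have h0 : HasRank Δ.subspaces ∅ 0 := (hasRank_iff hΔ.1 hs1).2 ⟨empty_mem, by simp⟩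
    rw [← ncard_hyperplanes_within hΔ.1 hs1 h0 hY (Set.empty_subset Y) (zero_add _)]
    simp

theorem HasOrder.ncard_hasRank_pos (hΔ : Δ.HasOrder s t) (hs1 : 1 < s) (hn : 1 < n) (hk : k ≤ n) :
    0 < {X | HasRank Δ.subspaces X k}.ncard := by
  induction k with
  | zero =>
    rw [Set.ncard_pos]
    exact ⟨∅, (hasRank_iff hΔ.1 hs1).2 ⟨empty_mem, by simp⟩⟩
  | succ k ih =>
    obtain ⟨d, hd⟩ := Nat.exists_eq_add_of_lt hk
    have h := hΔ.ncard_hasRank_succ_mul hs1 hn (k := k) (d := d) (by omega)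
    have h1 := ih (by omega)
    have h2 := projCard_pos hs1 (Nat.succ_pos d)
    refine Nat.pos_of_mul_pos_right (b := projCard s (k + 1)) ?_
    rw [h]
    positivity

/-! ### Logarithmic estimates and conclusion -/

/-- The exponent of `s` in `|Δ_k| / |Δ_{k-1}|`, up to a bounded error. -/
theorem HasOrder.logb_ncard_ofDim_succ_sub (hΔ : Δ.HasOrder s t) (hs1 : 1 < s) (ht : 0 < t)
    (hn : 1 < n) (hk : k + 1 < n) :
    2 * (n : ℝ) + Real.logb s t - 3 * k - 6 <
        Real.logb s (Δ.ofDim (k + 1)).ncard - Real.logb s (Δ.ofDim k).ncard ∧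
      Real.logb s (Δ.ofDim (k + 1)).ncard - Real.logb s (Δ.ofDim k).ncard <
        2 * (n : ℝ) + Real.logb s t - 3 * k - 3 := by
  obtain ⟨d, hd⟩ := Nat.exists_eq_add_of_lt hk
  have hrec := hΔ.ncard_hasRank_succ_mul hs1 hn (k := k + 1) (d := d) (by omega)
  have hpos := hΔ.ncard_hasRank_pos hs1 hn (k := k + 1) (by omega)
  have hpos' := hΔ.ncard_hasRank_pos hs1 hn (k := k + 1 + 1) (by omega)
  change 0 < (Δ.ofDim k).ncard at hpos
  change 0 < (Δ.ofDim (k + 1)).ncard at hpos'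
  change (Δ.ofDim (k + 1)).ncard * _ = (Δ.ofDim k).ncard * _ at hrec
  generalize (Δ.ofDim k).ncard = a at *
  generalize (Δ.ofDim (k + 1)).ncard = b at *
  have hs0 : 0 < s := by omega
  have hlow : a * (t * s ^ (d + d)) < b * s ^ (k + 2) := by
    calc a * (t * s ^ (d + d)) = a * (s ^ d * (t * s ^ d)) := by ring
      _ ≤ a * (projCard s (d + 1) * (1 + t * s ^ d)) := by
        gcongr
        · rw [projCard_succ]; omega
        · omega
      _ = b * projCard s (k + 1 + 1) := hrec.symm
      _ < b * s ^ (k + 2) := by gcongr; exact projCard_lt_pow hs1 _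
  have hupp : b * s ^ (k + 1) < a * (t * s ^ (d + 1 + (d + 1))) := by
    calc b * s ^ (k + 1) ≤ b * projCard s (k + 1 + 1) := by
          gcongr
          rw [projCard_succ]
          omega
      _ = a * (projCard s (d + 1) * (1 + t * s ^ d)) := hrec
      _ < a * (s ^ (d + 1) * (1 + t * s ^ d)) := by gcongr; exact projCard_lt_pow hs1 _
      _ ≤ a * (s ^ (d + 1) * (t * s ^ (d + 1))) := by
        gcongr
        -- For x = t s^d ≥ 1 and s ≥ 2, 1 + x ≤ s x.
        have : 0 < t * s ^ d := by positivity
        rw [pow_succ]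
        nlinarith
      _ = a * (t * s ^ (d + 1 + (d + 1))) := by ring
  have hsR : (1 : ℝ) < s := by exact_mod_cast hs1
  have log_eq : ∀ x m : ℕ, 0 < x → Real.logb s ((x * s ^ m : ℕ) : ℝ) = Real.logb s x + m := by
    intro x m hx
    have : (x : ℝ) ≠ 0 := by positivity
    push_cast
    rw [Real.logb_mul this (by positivity), Real.logb_pow, Real.logb_self_eq_one hsR, mul_one]
  have log_mul : Real.logb s ((a * t : ℕ) : ℝ) = Real.logb s a + Real.logb s t := by
    push_cast
    exact Real.logb_mul (by positivity) (by positivity)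
  have hat : 0 < a * t := by positivity
  rw [← mul_assoc] at hlow hupp
  have h1 := Real.logb_lt_logb hsR (by positivity) (Nat.cast_lt (α := ℝ).2 hlow)
  have h2 := Real.logb_lt_logb hsR (by positivity) (Nat.cast_lt (α := ℝ).2 hupp)
  rw [log_eq _ _ hat, log_eq _ _ hpos', log_mul] at h1 h2
  have hnR : (n : ℝ) = k + 1 + d + 1 := by exact_mod_cast hd
  push_cast at h1 h2
  constructor <;> linarith

/-- Telescoping: the sum of 3k over i ≤ k < j is 3(j - i)(i + j - 1)/2, and the error 6 or 3 per
step turns i + j - 1 into i + j + 3 or i + j + 1. -/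
theorem HasOrder.logb_ncard_ofDim_sub (hΔ : Δ.HasOrder s t) (hs1 : 1 < s) (ht : 0 < t)
    (hn : 1 < n) {i j : ℕ} (hij : i < j) (hj : j < n) :
    ((j : ℝ) - i) * (2 * n + Real.logb s t - 3 * (i + j + 3) / 2) <
        Real.logb s (Δ.ofDim j).ncard - Real.logb s (Δ.ofDim i).ncard ∧
      Real.logb s (Δ.ofDim j).ncard - Real.logb s (Δ.ofDim i).ncard <
        ((j : ℝ) - i) * (2 * n + Real.logb s t - 3 * (i + j + 1) / 2) := by
  induction j, hij using Nat.le_induction with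
  | base =>
    have h := hΔ.logb_ncard_ofDim_succ_sub hs1 ht hn hj
    push_cast
    constructor <;> linarith [h.1, h.2]
  | succ j hij ih =>
    have h := hΔ.logb_ncard_ofDim_succ_sub hs1 ht hn hj
    have h' := ih (by omega)
    push_cast
    constructor <;> nlinarith [h.1, h.2, h'.1, h'.2]

end PolarSpace

theorem exists_nat_two_mul_logb {s t : ℕ} (hs : 1 < s)
    (hst : (t : ℝ) ∈ ({1, (s : ℝ) ^ (1 / 2 : ℝ), (s : ℝ), (s : ℝ) ^ (3 / 2 : ℝ),
      (s : ℝ) ^ 2} : Set ℝ)) : ∃ e : ℕ, 2 * Real.logb s t = e := by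
  have hs0 : (0 : ℝ) < s := by positivity
  have hs1 : (s : ℝ) ≠ 1 := by exact_mod_cast hs.ne'
  rcases hst with h | h | h | h | h <;> rw [h]
  · exact ⟨0, by simp⟩
  · exact ⟨1, by rw [Real.logb_rpow hs0 hs1]; norm_num⟩
  · exact ⟨2, by rw [Real.logb_self_eq_one (by exact_mod_cast hs)]; norm_num⟩
  · exact ⟨3, by rw [Real.logb_rpow hs0 hs1]; norm_num⟩
  · exact ⟨4, by
      rw [Real.logb_pow, Real.logb_self_eq_one (by exact_mod_cast hs)]; norm_num⟩

theorem mainTheorem7 {P : Type*} [Finite P] (n s t : ℕ) (hn : 2 < n) (hs : 1 < s) (ht : 0 < t)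
    (hst : (t : ℝ) ∈ ({1, (s : ℝ) ^ (1 / 2 : ℝ), (s : ℝ), (s : ℝ) ^ (3 / 2 : ℝ),
      (s : ℝ) ^ 2} : Set ℝ))
    (Δ : PolarSpace P n) (hΔ : Δ.HasOrder s t)
    (i j : ℕ) (hij : i < j) (hj : j ≤ n - 1) :
    ((Δ.ofDim j).ncard ≤ (Δ.ofDim i).ncard →
      2 * (n : ℝ) + Real.logb (s : ℝ) (t : ℝ) < 3 * ((i : ℝ) + (j : ℝ) + 3) / 2) ∧
    ((Δ.ofDim i).ncard ≤ (Δ.ofDim j).ncard →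
      2 * (n : ℝ) + Real.logb (s : ℝ) (t : ℝ) > 3 * ((i : ℝ) + (j : ℝ) + 1) / 2) ∧
    ((Δ.ofDim i).ncard = (Δ.ofDim j).ncard →
      2 * (n : ℝ) + Real.logb (s : ℝ) (t : ℝ) - 2 ≥ 3 * ((i : ℝ) + (j : ℝ)) / 2 ∧
      3 * ((i : ℝ) + (j : ℝ)) / 2 ≥ 2 * (n : ℝ) + Real.logb (s : ℝ) (t : ℝ) - 4) := by
  obtain ⟨hlow, hupp⟩ := hΔ.logb_ncard_ofDim_sub hs ht (by omega) hij (by omega : j < n)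
  have hji : (0 : ℝ) < (j : ℝ) - i := sub_pos.2 (by exact_mod_cast hij)
  have hsR : (1 : ℝ) < s := by exact_mod_cast hs
  have hposj : 0 < (Δ.ofDim j).ncard := hΔ.ncard_hasRank_pos hs (by omega) (by omega)
  have hposi : 0 < (Δ.ofDim i).ncard := hΔ.ncard_hasRank_pos hs (by omega) (by omega)
  have ha : (Δ.ofDim j).ncard ≤ (Δ.ofDim i).ncard →
      2 * (n : ℝ) + Real.logb (s : ℝ) (t : ℝ) < 3 * ((i : ℝ) + (j : ℝ) + 3) / 2 := fun h => by
    have := Real.logb_le_logb_of_le hsR (by exact_mod_cast hposj) (Nat.cast_le (α := ℝ).2 h)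
    exact sub_neg.1 (neg_of_mul_neg_right (hlow.trans_le (sub_nonpos.2 this)) hji.le)
  have hb : (Δ.ofDim i).ncard ≤ (Δ.ofDim j).ncard →
      2 * (n : ℝ) + Real.logb (s : ℝ) (t : ℝ) > 3 * ((i : ℝ) + (j : ℝ) + 1) / 2 := fun h => by
    have := Real.logb_le_logb_of_le hsR (by exact_mod_cast hposi) (Nat.cast_le (α := ℝ).2 h)
    exact sub_pos.1 (pos_of_mul_pos_right ((sub_nonneg.2 this).trans_lt hupp) hji.le)
  refine ⟨ha, hb, fun h => ?_⟩
  have ha' := ha h.ge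
  have hb' := hb h.le
  obtain ⟨e, he⟩ := exists_nat_two_mul_logb hs hst
  -- Doubled, (a) and (b) compare natural numbers, so each strict inequality gains 1, which is the
  -- half unit needed in (c).
  have h1 : 4 * n + e < 3 * (i + j + 3) := by
    have : (4 : ℝ) * n + e < 3 * (i + j + 3) := by linarith
    exact_mod_cast this
  have h2 : 3 * (i + j + 1) < 4 * n + e := by
    have : (3 : ℝ) * (i + j + 1) < 4 * n + e := by linarith
    exact_mod_cast this
  have h1' : (4 : ℝ) * n + e + 1 ≤ 3 * (i + j + 3) := by exact_mod_cast h1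
  have h2' : (3 : ℝ) * (i + j + 1) + 1 ≤ 4 * n + e := by exact_mod_cast h2
  constructor <;> linarith
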